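/- Let $C_2$ be the cyclic group of order $2$, let $F_\omega$ be the free group of countably infinite rank, and let $G=(C_2\times F_\omega)*F_\omega$, where $*$ denotes the free product of groups. Then there are a set $X$ and an action of $G$ on $X$ that is sharply $2$-transitive of characteristic $2$. That is, $X$ has at least two elements; for all $x,y,w,z\in X$ with $x\neq y$ and $w\neq z$ there is exactly one $g\in G$ taking $x$ to $w$ and $y$ to $z$; and no involution of $G$ (that is, no $t\in G$ with $t\neq 1$ and $t^2=1$) fixes an element of $X$. -/

import Mathlib

/-- An action of `G` on `X` is sharply `n`-transitive if `X` has at least `n` elements and for any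
two `n`-tuples of pairwise distinct elements of `X` there is exactly one element of `G` taking the
first one to the second one. -/
structure IsSharplyMultiplyTransitive (G X : Type*) [Group G] [MulAction G X] (n : ℕ) : Prop where
  nonempty_tuples : Nonempty (Fin n ↪ X)
  existsUnique_smul_eq : ∀ x y : Fin n ↪ X, ∃! g : G, ∀ i, g • x i = y i

/-- The set of involutions of a group. -/
def involutions (G : Type*) [Group G] : Set G := {t | t ≠ 1 ∧ t ^ 2 = 1}

/-- A sharply `2`-transitive action has characteristic `2` if no involution has a fixed point. -/
structure IsSharplyTwoTransitiveOfCharTwo (G X : Type*) [Group G] [MulAction G X] : Prop where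
  isSharplyTwoTransitive : IsSharplyMultiplyTransitive G X 2
  involution_smul_ne : ∀ t ∈ involutions G, ∀ x : X, t • x ≠ x

/-! The group is a semidirect product `N ⋊ ⟨t⟩`, where `N` is free on generators fixed by `t` (the
central ones, `inl`) and on generators that `t` interchanges in pairs (`inr`). Let `t` act on `ℕ ×
Bool` by the fixed-point-free map `mate`. An action of the group is then an equivariant action of
the generators, and it is built as the union of a chain of finite partial actions.

Freeness on pairs is carried along by a potential: a group-valued function on pairs that is
multiplied on the left by a generator whenever the generator moves the pair. A word fixing a pair of
distinct points must then be trivial. The diagonal is exempt from the edge condition, since point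
stabilisers are nontrivial.

Two moves keep a potential. A generator undefined at a point may send it to an unused point
(`exists_addEdge_fresh`). A pair `(p, q)` of distinct points not yet connected to `(base, mate
base)` may be joined to it by an unused generator. If the component of `(p, q)` contains a pair of
mates, a central generator does this (`exists_addEdge_inl`). Otherwise the component is not
invariant under swapping (`exists_conn_mate`, because involutions outside `N` are conjugate to `t`
and `N` is torsion-free), and a non-central generator does it (`exists_addEdge_inr`).

In the limit all pairs of distinct points form one free orbit. Every involution is conjugate to `t`,
so none has a fixed point. -/

namespace PartialAction

/-! ### Generators, points and equivariant partial actions -/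

/-- Generators of the free normal subgroup of index two: `inl i` commutes with the distinguished
involution, while `inr (i, false)` and `inr (i, true)` are interchanged by it. -/
abbrev Generator := ℕ ⊕ (ℕ × Bool)

/-- The permutation of the generators induced by the distinguished involution. -/
def bar : Generator → Generator
  | .inl i => .inl i
  | .inr (i, b) => .inr (i, !b)

@[simp] theorem bar_bar (e : Generator) : bar (bar e) = e := by
  rcases e with i | ⟨i, b⟩ <;> simp [bar]

theorem bar_injective : Function.Injective bar :=
  Function.LeftInverse.injective bar_bar

/-- The points acted on. -/
abbrev Point := ℕ × Bool

/-- The fixed-point-free involution of the points. -/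
def mate (x : Point) : Point := (x.1, !x.2)

@[simp] theorem mate_mate (x : Point) : mate (mate x) = x := by simp [mate]

@[simp] theorem mate_ne (x : Point) : mate x ≠ x := by simp [mate, Prod.ext_iff]

@[simp] theorem ne_mate (x : Point) : x ≠ mate x := (mate_ne x).symm

theorem mate_injective : Function.Injective mate :=
  Function.LeftInverse.injective mate_mate

@[simp] theorem mate_fst (x : Point) : (mate x).1 = x.1 := rfl

/-- A family of binary relations on the points, indexed by the generators. -/
abbrev Rel := Generator → Point → Point → Prop

/-- Each generator acts by a partial injection, compatibly with the involution. -/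
structure IsPartialAction (R : Rel) : Prop where
  right_unique : ∀ {e x y z}, R e x y → R e x z → y = z
  left_unique : ∀ {e x y z}, R e x z → R e y z → x = y
  equivariant : ∀ {e x y}, R e x y → R (bar e) (mate x) (mate y)

/-- Prescribe that `e` takes `x` to `y`, and hence `bar e` takes `mate x` to `mate y`. -/
def addEdge (R : Rel) (e : Generator) (x y : Point) : Rel := fun e' u v =>
  R e' u v ∨ (e' = e ∧ u = x ∧ v = y) ∨ (e' = bar e ∧ u = mate x ∧ v = mate y)

theorem IsPartialAction.not_bar_left {R : Rel} (hR : IsPartialAction R) {e : Generator}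
    {x : Point} (hx : ∀ v, ¬ R e x v) (v : Point) : ¬ R (bar e) (mate x) v := fun h =>
  hx (mate v) (by simpa using hR.equivariant h)

theorem IsPartialAction.not_bar_right {R : Rel} (hR : IsPartialAction R) {e : Generator}
    {y : Point} (hy : ∀ u, ¬ R e u y) (u : Point) : ¬ R (bar e) u (mate y) := fun h =>
  hy (mate u) (by simpa using hR.equivariant h)

theorem IsPartialAction.addEdge {R : Rel} (hR : IsPartialAction R) {e : Generator} {x y : Point}
    (hx : ∀ v, ¬ R e x v) (hy : ∀ u, ¬ R e u y) : IsPartialAction (addEdge R e x y) where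
  right_unique := by
    rintro e' u v w (h | ⟨rfl, rfl, rfl⟩ | ⟨rfl, rfl, rfl⟩) (h' | ⟨h1, h2, rfl⟩ | ⟨h1, h2, rfl⟩)
    · exact hR.right_unique h h'
    · subst h1 h2; exact (hx _ h).elim
    · subst h1 h2; exact (hR.not_bar_left hx _ h).elim
    · exact (hx _ h').elim
    · rfl
    · exact (ne_mate _ h2).elim
    · exact (hR.not_bar_left hx _ h').elim
    · exact (mate_ne _ h2).elim
    · rfl
  left_unique := by
    rintro e' u v w (h | ⟨rfl, rfl, rfl⟩ | ⟨rfl, rfl, rfl⟩) (h' | ⟨h1, rfl, h2⟩ | ⟨h1, rfl, h2⟩)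
    · exact hR.left_unique h h'
    · subst h1 h2; exact (hy _ h).elim
    · subst h1 h2; exact (hR.not_bar_right hy _ h).elim
    · exact (hy _ h').elim
    · rfl
    · exact (ne_mate _ h2).elim
    · exact (hR.not_bar_right hy _ h').elim
    · exact (mate_ne _ h2).elim
    · rfl
  equivariant := by
    rintro e' u v (h | ⟨rfl, rfl, rfl⟩ | ⟨rfl, rfl, rfl⟩)
    · exact .inl (hR.equivariant h)
    · exact .inr (.inr ⟨rfl, rfl, rfl⟩)
    · exact .inr (.inl (by simp))

/-- The graph of a partial action. -/
def graph (R : Rel) : Set (Generator × Point × Point) := {p | R p.1 p.2.1 p.2.2}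

theorem finite_graph_addEdge {R : Rel} (hR : (graph R).Finite) (e : Generator) (x y : Point) :
    (graph (addEdge R e x y)).Finite := by
  refine (hR.union (Set.toFinite {(e, x, y), (bar e, mate x, mate y)})).subset ?_
  rintro ⟨e', u, v⟩ (h | ⟨h1, h2, h3⟩ | ⟨h1, h2, h3⟩)
  · exact .inl h
  · exact .inr (.inl (Prod.ext h1 (Prod.ext h2 h3)))
  · exact .inr (.inr (Prod.ext h1 (Prod.ext h2 h3)))

theorem exists_fresh_index {R : Rel} (hR : (graph R).Finite) (x : Point) :
    ∃ n : ℕ, x.1 ≠ n ∧ ∀ e u v, R e u v → u.1 ≠ n ∧ v.1 ≠ n := by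
  obtain ⟨n, hn⟩ := (((hR.image fun p => p.2.1.1).union (hR.image fun p => p.2.2.1)).insert
    x.1).exists_notMem
  refine ⟨n, fun h => hn (.inl h.symm), fun e u v h => ⟨fun h' => hn (.inr (.inl ?_)),
    fun h' => hn (.inr (.inr ?_))⟩⟩
  · exact ⟨(e, u, v), h, h'⟩
  · exact ⟨(e, u, v), h, h'⟩

theorem exists_fresh_generator {R : Rel} (hR : (graph R).Finite) {f : ℕ → Generator}
    (hf : Function.Injective f) : ∃ k, ∀ u v, ¬ R (f k) u v := by
  obtain ⟨k, hk⟩ := ((hR.image Prod.fst).preimage hf.injOn).exists_notMem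
  exact ⟨k, fun u v h => hk ⟨(f k, u, v), h, rfl⟩⟩

/-! ### Potentials, and their extension to fresh points -/

variable {Γ : Type*} [Group Γ]

/-- A function from the pairs of points to a group which intertwines the partial action with left
multiplication by the involution `T` and the weights `σ` of the generators. -/
structure IsPotential (R : Rel) (T : Γ) (σ : Generator → Γ) (Φ : Point → Point → Γ) : Prop where
  map_mate : ∀ x y, Φ (mate x) (mate y) = T * Φ x y
  map_edge : ∀ {e x x' y y'}, x ≠ y → R e x x' → R e y y' → Φ x' y' = σ e * Φ x y

/-- This symmetry reduces backward edges to forward ones. -/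
theorem IsPotential.inv {R : Rel} (hR : IsPartialAction R) {T : Γ} {σ : Generator → Γ}
    {Φ : Point → Point → Γ} (h : IsPotential R T σ Φ) :
    IsPotential (fun e x y => R e y x) T (fun e => (σ e)⁻¹) Φ where
  map_mate := h.map_mate
  map_edge := by
    intro e x x' y y' hxy hx hy
    have hne : x' ≠ y' := by
      rintro rfl
      exact hxy (hR.right_unique hx hy)
    rw [h.map_edge hne hx hy, inv_mul_cancel_left]

theorem IsPartialAction.inv {R : Rel} (hR : IsPartialAction R) :
    IsPartialAction (fun e x y => R e y x) where
  right_unique := fun h h' => hR.left_unique h h'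
  left_unique := fun h h' => hR.right_unique h h'
  equivariant := fun h => hR.equivariant h

/-- A potential extends when a generator is prescribed to take a point to an unused point. -/
theorem IsPotential.exists_addEdge_fresh {R : Rel} {T : Γ} {σ : Generator → Γ}
    {Φ : Point → Point → Γ} (h : IsPotential R T σ Φ) (hR : IsPartialAction R) (hT : T * T = 1)
    (hσ : ∀ e, σ (bar e) * T = T * σ e) {e : Generator} {x : Point} (hx : ∀ v, ¬ R e x v) {n : ℕ}
    (hxn : x.1 ≠ n) (hn : ∀ e u v, R e u v → u.1 ≠ n ∧ v.1 ≠ n) :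
    ∃ Φ', IsPotential (addEdge R e x (n, false)) T σ Φ' := by
  classical
  set R' := addEdge R e x (n, false) with hR'def
  have hR' : IsPartialAction R' := hR.addEdge hx fun u hu => (hn _ _ _ hu).2 rfl
  -- No edge leaves a fresh point, so values on pairs involving one are constrained only by incoming
  -- edges and by `mate`.
  have hsrc : ∀ {e' u v}, R' e' u v → u.1 ≠ n := by
    rintro e' u v (h | ⟨rfl, rfl, rfl⟩ | ⟨rfl, rfl, rfl⟩)
    exacts [(hn _ _ _ h).1, hxn, hxn]
  have hold : ∀ {e' u v}, R' e' u v → v.1 ≠ n → R e' u v := by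
    rintro e' u v (h | ⟨rfl, rfl, rfl⟩ | ⟨rfl, rfl, rfl⟩) hv
    exacts [h, (hv rfl).elim, (hv rfl).elim]
  -- Each fresh point has one incoming label, `e` or `bar e`, so at most one edge condition
  -- determines the value at a pair involving it.
  have huniq : ∀ {e₁ e₂ u₁ u₂ v}, R' e₁ u₁ v → R' e₂ u₂ v → v.1 = n → e₁ = e₂ := by
    rintro e₁ e₂ u₁ u₂ v (h₁ | ⟨rfl, rfl, rfl⟩ | ⟨rfl, rfl, rfl⟩) h₂ hv
    · exact ((hn _ _ _ h₁).2 hv).elim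
    · rcases h₂ with h₂ | ⟨rfl, rfl, -⟩ | ⟨-, -, h₂⟩
      exacts [((hn _ _ _ h₂).2 hv).elim, rfl, by simp [mate] at h₂]
    · rcases h₂ with h₂ | ⟨-, -, h₂⟩ | ⟨rfl, rfl, -⟩
      exacts [((hn _ _ _ h₂).2 hv).elim, by simp [mate] at h₂, rfl]
  -- Default value where no edge condition applies. Any function picking up `T` under `mate` would
  -- do; this one reads a single bit, which `mate` flips.
  let β : Point → Point → Γ := fun u v =>
    if u.1 = n then (if u.2 then T else 1) else (if v.2 then T else 1)
  have hβ : ∀ u v, β (mate u) (mate v) = T * β u v := by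
    intro u v
    rcases u with ⟨i, _ | _⟩ <;> rcases v with ⟨j, _ | _⟩ <;> by_cases hi : i = n <;>
      simp [β, mate, hi, hT]
  have key : ∀ u v, ∃ g : Γ, (u.1 ≠ n → v.1 ≠ n → g = Φ u v) ∧
      (u.1 = n ∨ v.1 = n → (∀ e' p q, R' e' p u → R' e' q v → g = σ e' * Φ p q) ∧
        ((¬ ∃ e' p q, R' e' p u ∧ R' e' q v) → g = β u v)) := by
    intro u v
    by_cases huv : u.1 = n ∨ v.1 = n
    · by_cases hp : ∃ e' p q, R' e' p u ∧ R' e' q v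
      · obtain ⟨e', p, q, hpu, hqv⟩ := hp
        refine ⟨σ e' * Φ p q, by tauto, fun _ => ⟨fun e'' p' q' hpu' hqv' => ?_,
          fun hne => (hne ⟨_, _, _, hpu, hqv⟩).elim⟩⟩
        obtain rfl : e' = e'' := huv.elim (huniq hpu hpu') (huniq hqv hqv')
        rw [hR'.left_unique hpu hpu', hR'.left_unique hqv hqv']
      · exact ⟨β u v, by tauto, fun _ => ⟨fun e' p q h₁ h₂ => (hp ⟨_, _, _, h₁, h₂⟩).elim,
          fun _ => rfl⟩⟩
    · exact ⟨Φ u v, fun _ _ => rfl, fun h => (huv h).elim⟩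
  choose Φ' hΦ₁ hΦ₂ using key
  refine ⟨Φ', ⟨fun u v => ?_, fun {e' u u' v v'} huv hu hv => ?_⟩⟩
  · by_cases huv : u.1 = n ∨ v.1 = n
    · by_cases hp : ∃ e' p q, R' e' p u ∧ R' e' q v
      · obtain ⟨e', p, q, hpu, hqv⟩ := hp
        rw [(hΦ₂ u v huv).1 _ _ _ hpu hqv, (hΦ₂ (mate u) (mate v) huv).1 _ _ _
          (hR'.equivariant hpu) (hR'.equivariant hqv), h.map_mate, ← mul_assoc, hσ, mul_assoc]
      · rw [(hΦ₂ u v huv).2 hp, (hΦ₂ (mate u) (mate v) huv).2, hβ]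
        rintro ⟨e', p, q, hpu, hqv⟩
        exact hp ⟨_, _, _, by simpa using hR'.equivariant hpu, by simpa using hR'.equivariant hqv⟩
    · push Not at huv
      rw [hΦ₁ u v huv.1 huv.2, hΦ₁ _ _ (by simpa using huv.1) (by simpa using huv.2), h.map_mate]
  · rw [hΦ₁ u v (hsrc hu) (hsrc hv)]
    by_cases huv' : u'.1 = n ∨ v'.1 = n
    · exact (hΦ₂ u' v' huv').1 _ _ _ hu hv
    · push Not at huv'
      rw [hΦ₁ _ _ huv'.1 huv'.2, h.map_edge huv (hold hu huv'.1) (hold hv huv'.2)]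

/-! ### Words and components of pairs -/

/-- A signed generator takes `x` to `y`. -/
def Step (R : Rel) (l : Generator × Bool) (x y : Point) : Prop :=
  if l.2 then R l.1 x y else R l.1 y x

/-- A word, read from right to left, takes `x` to `y`. -/
def Acts (R : Rel) : List (Generator × Bool) → Point → Point → Prop
  | [], x, y => x = y
  | l :: L, x, y => ∃ u, Acts R L x u ∧ Step R l u y

theorem IsPartialAction.step_right_unique {R : Rel} (hR : IsPartialAction R)
    {l : Generator × Bool} {x y z : Point} (h : Step R l x y) (h' : Step R l x z) : y = z := by
  rcases l with ⟨e, _ | _⟩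
  exacts [hR.left_unique h h', hR.right_unique h h']

theorem step_not {R : Rel} {e : Generator} {b : Bool} {x y : Point} :
    Step R (e, !b) x y ↔ Step R (e, b) y x := by
  cases b <;> rfl

theorem IsPartialAction.step_mate {R : Rel} (hR : IsPartialAction R) {e : Generator} {b : Bool}
    {x y : Point} (h : Step R (e, b) x y) : Step R (bar e, b) (mate x) (mate y) := by
  cases b
  exacts [hR.equivariant (show R e y x from h), hR.equivariant (show R e x y from h)]

theorem acts_append {R : Rel} {L M : List (Generator × Bool)} {x y : Point} :
    Acts R (L ++ M) x y ↔ ∃ u, Acts R M x u ∧ Acts R L u y := by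
  induction L generalizing y with
  | nil => simp [Acts]
  | cons l L ih =>
    simp only [List.cons_append, Acts, ih]
    exact ⟨fun ⟨u, ⟨v, h₁, h₂⟩, h₃⟩ => ⟨v, h₁, u, h₂, h₃⟩,
      fun ⟨v, h₁, u, h₂, h₃⟩ => ⟨u, ⟨v, h₁, h₂⟩, h₃⟩⟩

theorem acts_singleton {R : Rel} {l : Generator × Bool} {x y : Point} :
    Acts R [l] x y ↔ Step R l x y := by
  simp [Acts]

/-- The permutation of the words induced by the distinguished involution. -/
def barWord (L : List (Generator × Bool)) : List (Generator × Bool) := L.map (Prod.map bar id)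

theorem IsPartialAction.acts_barWord {R : Rel} (hR : IsPartialAction R)
    {L : List (Generator × Bool)} {x y : Point} (h : Acts R L x y) :
    Acts R (barWord L) (mate x) (mate y) := by
  induction L generalizing y with
  | nil => exact congrArg mate h
  | cons l L ih =>
    obtain ⟨u, h₁, h₂⟩ := h
    exact ⟨mate u, ih h₁, hR.step_mate h₂⟩

/-- Cancelling a letter against its inverse can only enlarge the domain of a product of partial
injections, so only this direction holds. -/
theorem IsPartialAction.acts_of_red {R : Rel} (hR : IsPartialAction R)
    {L M : List (Generator × Bool)} (hLM : FreeGroup.Red L M) {x y : Point} (h : Acts R L x y) :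
    Acts R M x y := by
  induction hLM with
  | refl => exact h
  | tail _ hs ih =>
    rcases hs with @⟨L₁, L₂, e, b⟩
    obtain ⟨u, ⟨v, ⟨w, h₁, h₂⟩, h₃⟩, h₄⟩ := acts_append.1 ih
    have : w = u := hR.step_right_unique (step_not.1 h₂) h₃
    exact acts_append.2 ⟨w, h₁, this ▸ h₄⟩

theorem acts_mono {R R' : Rel} (hRR' : ∀ e x y, R e x y → R' e x y)
    {L : List (Generator × Bool)} {x y : Point} (h : Acts R L x y) : Acts R' L x y := by
  induction L generalizing y with
  | nil => exact h
  | cons l L ih =>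
    obtain ⟨u, h₁, h₂⟩ := h
    refine ⟨u, ih h₁, ?_⟩
    rcases l with ⟨e, _ | _⟩
    exacts [hRR' _ _ _ h₂, hRR' _ _ _ h₂]

theorem IsPotential.map_step {R : Rel} {T : Γ} {σ : Generator → Γ} {Φ : Point → Point → Γ}
    (h : IsPotential R T σ Φ) (hR : IsPartialAction R) {e : Generator} {b : Bool}
    {x x' y y' : Point} (hxy : x ≠ y) (hx : Step R (e, b) x x') (hy : Step R (e, b) y y') :
    Φ x' y' = (if b then σ e else (σ e)⁻¹) * Φ x y := by
  cases b
  · exact (h.inv hR).map_edge hxy hx hy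
  · exact h.map_edge hxy hx hy

theorem IsPartialAction.step_ne {R : Rel} (hR : IsPartialAction R) {l : Generator × Bool}
    {x x' y y' : Point} (hxy : x ≠ y) (hx : Step R l x x') (hy : Step R l y y') : x' ≠ y' := by
  rintro rfl
  rcases l with ⟨e, b⟩
  exact hxy (hR.step_right_unique (step_not.2 hx) (step_not.2 hy))

theorem IsPartialAction.acts_ne {R : Rel} (hR : IsPartialAction R) {L : List (Generator × Bool)}
    {x x' y y' : Point} (hxy : x ≠ y) (hx : Acts R L x x') (hy : Acts R L y y') : x' ≠ y' := by
  induction L generalizing x' y' with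
  | nil => exact hx ▸ hy ▸ hxy
  | cons l L ih =>
    obtain ⟨u, hu, hx⟩ := hx
    obtain ⟨v, hv, hy⟩ := hy
    exact hR.step_ne (ih hu hv) hx hy

theorem IsPotential.map_acts {R : Rel} {T : Γ} {σ : Generator → Γ} {Φ : Point → Point → Γ}
    (h : IsPotential R T σ Φ) (hR : IsPartialAction R) {L : List (Generator × Bool)}
    {x x' y y' : Point} (hxy : x ≠ y) (hx : Acts R L x x') (hy : Acts R L y y') :
    Φ x' y' = FreeGroup.lift σ (FreeGroup.mk L) * Φ x y := by
  induction L generalizing x' y' with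
  | nil => simp [← show x = x' from hx, ← show y = y' from hy, ← FreeGroup.one_eq_mk]
  | cons l L ih =>
    obtain ⟨u, hu, hx⟩ := hx
    obtain ⟨v, hv, hy⟩ := hy
    rw [h.map_step hR (hR.acts_ne hxy hu hv) hx hy, ih hu hv, ← mul_assoc]
    congr 1
    simp only [FreeGroup.lift_mk, List.map_cons, List.prod_cons]
    cases l.2 <;> rfl

/-- Two pairs of points are connected if a word takes the first pair to the second one or to its
mate. -/
def Conn (R : Rel) (x y u v : Point) : Prop :=
  ∃ L, (Acts R L x u ∧ Acts R L y v) ∨ (Acts R L x (mate u) ∧ Acts R L y (mate v))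

theorem Conn.refl (R : Rel) (x y : Point) : Conn R x y x y := ⟨[], .inl ⟨rfl, rfl⟩⟩

theorem Conn.swap {R : Rel} {x y u v : Point} (h : Conn R x y u v) : Conn R y x v u := by
  obtain ⟨L, h⟩ := h
  exact ⟨L, h.imp And.symm And.symm⟩

theorem Conn.mate {R : Rel} {x y u v : Point} (h : Conn R x y u v) :
    Conn R x y (mate u) (mate v) := by
  obtain ⟨L, h | h⟩ := h
  exacts [⟨L, .inr (by simpa using h)⟩, ⟨L, .inl h⟩]

theorem conn_mate {R : Rel} {x y u v : Point} :
    Conn R x y (PartialAction.mate u) (PartialAction.mate v) ↔ Conn R x y u v :=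
  ⟨fun h => by simpa using h.mate, Conn.mate⟩

theorem Conn.step {R : Rel} (hR : IsPartialAction R) {x y u v u' v' : Point} {e : Generator}
    {b : Bool} (h : Conn R x y u v) (hu : Step R (e, b) u u') (hv : Step R (e, b) v v') :
    Conn R x y u' v' := by
  obtain ⟨L, h | h⟩ := h
  · exact ⟨(e, b) :: L, .inl ⟨⟨u, h.1, hu⟩, ⟨v, h.2, hv⟩⟩⟩
  · exact ⟨(bar e, b) :: L, .inr ⟨⟨_, h.1, hR.step_mate hu⟩, ⟨_, h.2, hR.step_mate hv⟩⟩⟩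

/-! ### Rescaling potentials and joining components -/

/-- The value of a potential at a pair can be prescribed without changing it on the other connected
components. -/
theorem IsPotential.exists_rescale {R : Rel} {T : Γ} {σ : Generator → Γ} {Φ : Point → Point → Γ}
    (h : IsPotential R T σ Φ) (hR : IsPartialAction R) (p q : Point) (g : Γ) :
    ∃ Φ', IsPotential R T σ Φ' ∧ Φ' p q = g ∧ ∀ u v, ¬ Conn R p q u v → Φ' u v = Φ u v := by
  classical
  -- The conditions on a potential are left multiplications, so multiplying on the right by a
  -- constant on one component preserves them.
  refine ⟨fun u v => if Conn R p q u v then Φ u v * ((Φ p q)⁻¹ * g) else Φ u v, ⟨?_, ?_⟩, ?_, ?_⟩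
  · intro u v
    simp only [conn_mate, h.map_mate]
    split_ifs <;> simp only [mul_assoc]
  · intro e u u' v v' huv hu hv
    have : Conn R p q u' v' ↔ Conn R p q u v :=
      ⟨fun hc => hc.step hR (b := false) hu hv, fun hc => hc.step hR (b := true) hu hv⟩
    simp only [this, h.map_edge huv hu hv]
    split_ifs <;> simp only [mul_assoc]
  · simp [Conn.refl]
  · intro u v huv
    simp [huv]

/-- A potential extends when an unused central generator joins two components, each of which
contains a pair of mates. -/
theorem IsPotential.exists_addEdge_inl {R : Rel} {T : Γ} {σ : Generator → Γ}
    {Φ : Point → Point → Γ} (h : IsPotential R T σ Φ) (hR : IsPartialAction R)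
    (hσ : ∀ e, σ (bar e) * T = T * σ e) {k : ℕ} (hk : ∀ u v, ¬ R (.inl k) u v) {o x : Point}
    (hox : ¬ Conn R x (mate x) o (mate o)) :
    ∃ Φ', IsPotential (addEdge R (.inl k) o x) T σ Φ' := by
  obtain ⟨Φ', h', hx, ho⟩ := h.exists_rescale hR x (mate x) (σ (.inl k) * Φ o (mate o))
  replace ho := ho _ _ hox
  -- For pairs of mates, swapping is the same as applying `mate`, so the condition at the swapped
  -- pair follows from the one just imposed.
  have hflip : Φ' (mate x) x = σ (.inl k) * Φ' (mate o) o := by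
    have h₁ := h'.map_mate x (mate x)
    have h₂ := h'.map_mate o (mate o)
    rw [mate_mate] at h₁ h₂
    rw [h₁, h₂, hx, ho, ← mul_assoc, ← mul_assoc, ← hσ]
    rfl
  refine ⟨Φ', ⟨h'.map_mate, ?_⟩⟩
  intro e u u' v v' huv hu hv
  rcases hu with hu | ⟨rfl, rfl, rfl⟩ | ⟨rfl, rfl, rfl⟩
  · rcases hv with hv | ⟨rfl, rfl, rfl⟩ | ⟨rfl, rfl, rfl⟩
    exacts [h'.map_edge huv hu hv, (hk _ _ hu).elim, (hk _ _ hu).elim]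
  · rcases hv with hv | ⟨-, rfl, rfl⟩ | ⟨-, rfl, rfl⟩
    exacts [(hk _ _ hv).elim, (huv rfl).elim, by rw [hx, ho]]
  · rcases hv with hv | ⟨-, rfl, rfl⟩ | ⟨-, rfl, rfl⟩
    exacts [(hk _ _ hv).elim, hflip, (huv rfl).elim]

/-- A potential extends when an unused non-central generator joins the component of a pair of mates
to a component which is not invariant under swapping the points. -/
theorem IsPotential.exists_addEdge_inr {R : Rel} {T : Γ} {σ : Generator → Γ}
    {Φ : Point → Point → Γ} (h : IsPotential R T σ Φ) (hR : IsPartialAction R)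
    (hσ : ∀ e, σ (bar e) * T = T * σ e) {k : ℕ} (hk : ∀ u v, ¬ R (.inr (k, false)) u v)
    {o x y : Point} (hox : ¬ Conn R x y o (mate o)) (hxy : ¬ Conn R x y y x) :
    ∃ Φ', IsPotential
      (addEdge (addEdge R (.inr (k, false)) o x) (.inr (k, false)) (mate o) y) T σ Φ' := by
  set b : Generator := .inr (k, false) with hb
  have hk' : ∀ u v, ¬ R (bar b) u v := fun u v hu =>
    hk (mate u) (mate v) (by simpa using hR.equivariant hu)
  have hbb : b ≠ bar b := by simp [hb, bar]
  -- The new edges impose conditions at `(x, y)`, `(y, x)` and their mates. The first two lie in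
  -- different components and can be met independently; the other two follow by equivariance.
  obtain ⟨Φ₁, h₁, hx₁, ho₁⟩ := h.exists_rescale hR x y (σ b * Φ o (mate o))
  obtain ⟨Φ₂, h₂, hx₂, ho₂⟩ := h₁.exists_rescale hR y x (σ b * Φ (mate o) o)
  have hox' : ¬ Conn R x y (mate o) o := fun hc => hox (by simpa using hc.mate)
  have e₁ : Φ₂ x y = σ b * Φ₂ o (mate o) := by
    rw [ho₂ _ _ (fun hc => hxy hc.swap), hx₁, ho₂ _ _ (fun hc => hox' hc.swap), ho₁ _ _ hox]
  have e₂ : Φ₂ y x = σ b * Φ₂ (mate o) o := by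
    rw [hx₂, ho₂ _ _ (fun hc => hox hc.swap), ho₁ _ _ hox']
  have e₃ : Φ₂ (mate x) (mate y) = σ (bar b) * Φ₂ (mate o) o := by
    have := h₂.map_mate o (mate o)
    rw [mate_mate] at this
    rw [h₂.map_mate, this, e₁, ← mul_assoc, ← hσ, mul_assoc]
  have e₄ : Φ₂ (mate y) (mate x) = σ (bar b) * Φ₂ o (mate o) := by
    have := h₂.map_mate (mate o) o
    rw [mate_mate] at this
    rw [h₂.map_mate, this, e₂, ← mul_assoc, ← hσ, mul_assoc]
  have hedge : ∀ {e u u'}, addEdge (addEdge R b o x) b (mate o) y e u u' → R e u u' ∨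
      (e = b ∧ (u = o ∧ u' = x ∨ u = mate o ∧ u' = y)) ∨
      (e = bar b ∧ (u = mate o ∧ u' = mate x ∨ u = o ∧ u' = mate y)) := by
    rintro e u u' ((h | h | h) | h | h) <;> simp_all
  refine ⟨Φ₂, ⟨h₂.map_mate, ?_⟩⟩
  intro e u u' v v' huv hu hv
  replace hu := hedge hu
  replace hv := hedge hv
  rcases hu with hu | ⟨rfl, hu⟩ | ⟨rfl, hu⟩
  · rcases hv with hv | ⟨rfl, hv⟩ | ⟨rfl, hv⟩
    exacts [h₂.map_edge huv hu hv, (hk _ _ hu).elim, (hk' _ _ hu).elim]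
  · rcases hv with hv | ⟨-, hv⟩ | ⟨hv, -⟩
    · exact (hk _ _ hv).elim
    · rcases hu with ⟨rfl, rfl⟩ | ⟨rfl, rfl⟩ <;> rcases hv with ⟨rfl, rfl⟩ | ⟨rfl, rfl⟩
      exacts [(huv rfl).elim, e₁, e₂, (huv rfl).elim]
    · exact (hbb hv).elim
  · rcases hv with hv | ⟨hv, -⟩ | ⟨-, hv⟩
    · exact (hk' _ _ hv).elim
    · exact (hbb hv.symm).elim
    · rcases hu with ⟨rfl, rfl⟩ | ⟨rfl, rfl⟩ <;> rcases hv with ⟨rfl, rfl⟩ | ⟨rfl, rfl⟩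
      exacts [(huv rfl).elim, e₃, e₄, (huv rfl).elim]

/-! ### Components invariant under swapping -/

theorem isReduced_barWord {L : List (Generator × Bool)} (hL : FreeGroup.IsReduced L) :
    FreeGroup.IsReduced (barWord L) := by
  refine (List.isChain_map _).2 (hL.imp ?_)
  intro a b hab h
  exact hab (bar_injective h)

/-- Here `L` followed by the involution swaps `p` and `q`. Its square fixes the pair, so `bar L` is
the inverse of `L`. Thus `L` begins and ends with letters that a twisted conjugation removes;
stripping them reaches the empty word, where `p` and `q` are mates. -/
theorem IsPotential.exists_conn_mate_of_acts {R : Rel} {T : Γ} {σ : Generator → Γ}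
    {Φ : Point → Point → Γ} (h : IsPotential R T σ Φ) (hR : IsPartialAction R)
    (hinj : Function.Injective (FreeGroup.lift σ)) {x y : Point} (n : ℕ) :
    ∀ (L : List (Generator × Bool)) (p q : Point), L.length ≤ n → FreeGroup.IsReduced L → p ≠ q →
      Acts R L p (mate q) → Acts R L q (mate p) → Conn R x y p q →
      ∃ u, Conn R x y u (mate u) := by
  induction n using Nat.strong_induction_on with
  | _ n ih =>
  intro L p q hn hL hpq hp hq hc
  have hclosed : ∀ {p q}, Acts R L p (mate q) → Acts R L q (mate p) →
      Acts R (barWord L ++ L) p p := fun hp hq =>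
    acts_append.2 ⟨_, hp, by simpa using hR.acts_barWord hq⟩
  have hone : FreeGroup.mk (barWord L ++ L) = 1 := by
    apply hinj
    rw [map_one]
    exact mul_eq_right.1 (h.map_acts hR hpq (hclosed hp hq) (hclosed hq hp)).symm
  -- Both sides are reduced, so equality in the free group is equality of words.
  have hinv : barWord L = FreeGroup.invRev L := by
    rw [← FreeGroup.mul_mk, mul_eq_one_iff_eq_inv, FreeGroup.inv_mk] at hone
    have := FreeGroup.reduce.sound hone
    rwa [(isReduced_barWord hL).reduce_eq, FreeGroup.reduce_invRev, hL.reduce_eq] at this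
  rcases L with _ | ⟨⟨e, b⟩, L'⟩
  · obtain rfl : p = mate q := hp
    exact ⟨mate q, by simpa using hc⟩
  · rcases L'.eq_nil_or_concat with rfl | ⟨M, ⟨e', b'⟩, rfl⟩
    -- A single letter is impossible: `barWord` keeps its sign while inversion changes it.
    · simp [barWord, FreeGroup.invRev] at hinv
    · have hhead : bar e = e' ∧ b = !b' := by
        have := congrArg List.head? hinv
        simpa [barWord, FreeGroup.invRev] using this
      obtain ⟨rfl, rfl⟩ := hhead
      rw [List.concat_eq_append] at *
      obtain ⟨p₂, hp₂, hp₃⟩ := hp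
      obtain ⟨q₂, hq₂, hq₃⟩ := hq
      obtain ⟨p₁, hp₁, hp₂⟩ := acts_append.1 hp₂
      obtain ⟨q₁, hq₁, hq₂⟩ := acts_append.1 hq₂
      rw [acts_singleton] at hp₁ hq₁
      -- The outermost letter undoes the mate of the innermost one, so the middle word `M` satisfies
      -- the same hypotheses at `(p₁, q₁)`.
      have key : ∀ {p₂ q q₁ : Point}, Step R (e, !b') p₂ (mate q) → Step R (bar e, b') q q₁ →
          p₂ = mate q₁ := fun hp₃ hq₁ => by
        refine hR.step_right_unique (step_not.1 hp₃) ?_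
        simpa using hR.step_mate hq₁
      rw [key hp₃ hq₁] at hp₂
      rw [key hq₃ hp₁] at hq₂
      refine ih M.length ?_ M p₁ q₁ le_rfl ?_ (hR.step_ne hpq hp₁ hq₁) hp₂ hq₂
        (hc.step hR hp₁ hq₁)
      · simp at hn; omega
      · exact hL.infix ⟨[(e, !b')], [(bar e, b')], by simp⟩

/-- If swapping the points of a pair preserves its component, then the component contains a pair of
mates. -/
theorem IsPotential.exists_conn_mate {R : Rel} {T : Γ} {σ : Generator → Γ}
    {Φ : Point → Point → Γ} (h : IsPotential R T σ Φ) (hR : IsPartialAction R)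
    (hinj : Function.Injective (FreeGroup.lift σ)) {x y : Point} (hxy : x ≠ y)
    (hc : Conn R x y y x) : ∃ u, Conn R x y u (mate u) := by
  obtain ⟨L, ⟨hx, hy⟩ | ⟨hx, hy⟩⟩ := hc
  -- A swap by a word alone would have trivial square, hence be trivial, as free groups are
  -- torsion-free.
  · exfalso
    have hone : FreeGroup.mk L * FreeGroup.mk L = 1 := by
      rw [FreeGroup.mul_mk]
      apply hinj
      rw [map_one]
      exact mul_eq_right.1 (h.map_acts hR hxy (acts_append.2 ⟨_, hx, hy⟩)
        (acts_append.2 ⟨_, hy, hx⟩)).symm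
    rw [← sq, pow_eq_one_iff_left two_ne_zero, FreeGroup.one_eq_mk] at hone
    have hred : FreeGroup.reduce L = [] := by simpa using FreeGroup.reduce.sound hone
    exact hxy (hred ▸ hR.acts_of_red FreeGroup.reduce.red hx : Acts R [] x y)
  · exact h.exists_conn_mate_of_acts hR hinj _ (FreeGroup.reduce L) x y le_rfl
      (FreeGroup.IsReduced.of_reduce_eq FreeGroup.reduce.idem) hxy
      (hR.acts_of_red FreeGroup.reduce.red hx) (hR.acts_of_red FreeGroup.reduce.red hy)
      (Conn.refl R x y)

/-! ### Extending finite states -/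

/-- A finite partial action which admits a potential. -/
structure IsState (T : Γ) (σ : Generator → Γ) (R : Rel) : Prop where
  isPartialAction : IsPartialAction R
  finite : (graph R).Finite
  exists_potential : ∃ Φ, IsPotential R T σ Φ

/-- The base point. -/
def base : Point := (0, false)

theorem addEdge_le (R : Rel) (e : Generator) (x y : Point) : R ≤ addEdge R e x y :=
  fun _ _ _ h => .inl h

theorem Conn.acts {R : Rel} (hR : IsPartialAction R) {x y u v u' v' : Point}
    {L : List (Generator × Bool)} (h : Conn R x y u v) (hu : Acts R L u u') (hv : Acts R L v v') :
    Conn R x y u' v' := by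
  induction L generalizing u' v' with
  | nil => rwa [← show u = u' from hu, ← show v = v' from hv]
  | cons l L ih =>
    obtain ⟨u₁, hu₁, hu⟩ := hu
    obtain ⟨v₁, hv₁, hv⟩ := hv
    exact (ih hu₁ hv₁).step hR hu hv

theorem Conn.trans {R : Rel} (hR : IsPartialAction R) {x y u v w z : Point} (h : Conn R x y u v)
    (h' : Conn R u v w z) : Conn R x y w z := by
  obtain ⟨L, ⟨hu, hv⟩ | ⟨hu, hv⟩⟩ := h'
  exacts [h.acts hR hu hv, conn_mate.1 (h.acts hR hu hv)]

theorem Conn.mono {R R' : Rel} (hRR' : R ≤ R') {x y u v : Point} (h : Conn R x y u v) :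
    Conn R' x y u v := by
  obtain ⟨L, h⟩ := h
  exact ⟨L, h.imp (And.imp (acts_mono hRR') (acts_mono hRR'))
    (And.imp (acts_mono hRR') (acts_mono hRR'))⟩

theorem step_mono {R R' : Rel} (hRR' : R ≤ R') {l : Generator × Bool} {x y : Point}
    (h : Step R l x y) : Step R' l x y :=
  acts_singleton.1 (acts_mono hRR' (acts_singleton.2 h))

theorem finite_graph_inv {R : Rel} (hR : (graph R).Finite) :
    (graph fun e x y => R e y x).Finite := by
  refine (hR.image fun p => (p.1, p.2.2, p.2.1)).subset ?_
  rintro ⟨e, x, y⟩ h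
  exact ⟨(e, y, x), h, rfl⟩

theorem IsState.inv {T : Γ} {σ : Generator → Γ} {R : Rel} (h : IsState T σ R) :
    IsState T (fun e => (σ e)⁻¹) (fun e x y => R e y x) := by
  obtain ⟨Φ, hΦ⟩ := h.exists_potential
  exact ⟨h.1.inv, finite_graph_inv h.2, Φ, hΦ.inv h.1⟩

theorem IsState.exists_edge {T : Γ} {σ : Generator → Γ} {R : Rel} (h : IsState T σ R)
    (hT : T * T = 1) (hσ : ∀ e, σ (bar e) * T = T * σ e) (e : Generator) (x : Point) :
    ∃ R', IsState T σ R' ∧ R ≤ R' ∧ ∃ y, R' e x y := by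
  by_cases hx : ∃ y, R e x y
  · exact ⟨R, h, le_rfl, hx⟩
  · push Not at hx
    obtain ⟨n, hxn, hn⟩ := exists_fresh_index h.finite x
    obtain ⟨Φ, hΦ⟩ := h.exists_potential
    exact ⟨_, ⟨h.1.addEdge hx fun u hu => (hn _ _ _ hu).2 rfl, finite_graph_addEdge h.2 _ _ _,
      hΦ.exists_addEdge_fresh h.1 hT hσ hx hxn hn⟩, addEdge_le _ _ _ _, _, .inr (.inl ⟨rfl, rfl, rfl⟩)⟩

theorem IsState.exists_step {T : Γ} {σ : Generator → Γ} {R : Rel} (h : IsState T σ R)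
    (hT : T * T = 1) (hσ : ∀ e, σ (bar e) * T = T * σ e) (l : Generator × Bool) (x : Point) :
    ∃ R', IsState T σ R' ∧ R ≤ R' ∧ ∃ y, Step R' l x y := by
  rcases l with ⟨e, _ | _⟩
  · have hT' : T⁻¹ = T := inv_eq_of_mul_eq_one_left hT
    -- A backward step is a forward step of the reversed state, whose weights satisfy the same
    -- relation because `T` is its own inverse.
    have hσ' : ∀ e, (σ (bar e))⁻¹ * T = T * (σ e)⁻¹ := fun e => by
      have := congrArg (·⁻¹) (hσ (bar e))
      simp only [mul_inv_rev, hT', bar_bar] at this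
      exact this.symm
    obtain ⟨R', h', hle, y, hy⟩ := h.inv.exists_edge hT hσ' e x
    refine ⟨fun e x y => R' e y x, by simpa using h'.inv, fun e u v huv => hle e v u huv, y, hy⟩
  · exact h.exists_edge hT hσ e x

theorem IsState.exists_conn {T : Γ} {σ : Generator → Γ} {R : Rel} (h : IsState T σ R)
    (hσ : ∀ e, σ (bar e) * T = T * σ e) (hinj : Function.Injective (FreeGroup.lift σ))
    {p q : Point} (hpq : p ≠ q) :
    ∃ R', IsState T σ R' ∧ R ≤ R' ∧ Conn R' p q base (mate base) := by
  by_cases ho : Conn R p q base (mate base)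
  · exact ⟨R, h, le_rfl, ho⟩
  obtain ⟨hR, hfin, Φ, hΦ⟩ := h
  by_cases hqp : Conn R p q q p
  · obtain ⟨u, hu⟩ := hΦ.exists_conn_mate hR hinj hpq hqp
    obtain ⟨k, hk⟩ := exists_fresh_generator hfin Sum.inl_injective
    -- The edge from `base` to `u` carries `mate base` to `mate u`, because the generator is its own
    -- `bar`.
    have hne : ¬ Conn R u (mate u) base (mate base) := fun hc => ho (hu.trans hR hc)
    have hR' := hR.addEdge (hk base) (fun v => hk v u)
    refine ⟨_, ⟨hR', finite_graph_addEdge hfin _ _ _, hΦ.exists_addEdge_inl hR hσ hk hne⟩,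
      addEdge_le _ _ _ _, ?_⟩
    exact (hu.mono (addEdge_le _ _ _ _)).step (b := false) hR' (.inr (.inl ⟨rfl, rfl, rfl⟩))
      (.inr (.inr ⟨rfl, rfl, rfl⟩))
  · obtain ⟨k, hk⟩ := exists_fresh_generator hfin (f := fun k => .inr (k, false))
      (fun a b hab => by simpa using hab)
    have hR' := hR.addEdge (hk base) (fun v => hk v p)
    have hR'' := hR'.addEdge (x := mate base) (y := q) (e := .inr (k, false))
      (by rintro v (h | ⟨-, h, -⟩ | ⟨h, -, -⟩)
          exacts [hk _ _ h, mate_ne _ h, by simp [bar] at h])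
      (by rintro v (h | ⟨-, -, h⟩ | ⟨h, -, -⟩)
          exacts [hk _ _ h, hpq h.symm, by simp [bar] at h])
    refine ⟨_, ⟨hR'', finite_graph_addEdge (finite_graph_addEdge hfin _ _ _) _ _ _,
      hΦ.exists_addEdge_inr hR hσ hk ho hqp⟩,
      (addEdge_le _ _ _ _).trans (addEdge_le _ _ _ _), ?_⟩
    exact (Conn.refl _ p q).step (b := false) hR'' (.inl (.inr (.inl ⟨rfl, rfl, rfl⟩)))
      (.inr (.inl ⟨rfl, rfl, rfl⟩))

theorem isState_bot {T : Γ} (hT : T * T = 1) (σ : Generator → Γ) :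
    IsState T σ (fun _ _ _ => False) where
  isPartialAction := ⟨False.elim, False.elim, False.elim⟩
  finite := by simp [graph]
  exists_potential := by
    refine ⟨fun x _ => if x.2 then T else 1, fun x y => ?_, fun _ h => h.elim⟩
    rcases x with ⟨i, _ | _⟩ <;> simp [mate, hT]

theorem IsState.exists_task {T : Γ} {σ : Generator → Γ} {R : Rel} (h : IsState T σ R)
    (hT : T * T = 1) (hσ : ∀ e, σ (bar e) * T = T * σ e)
    (hinj : Function.Injective (FreeGroup.lift σ)) (l : Generator × Bool) (p q : Point) :
    ∃ R', IsState T σ R' ∧ R ≤ R' ∧ (∃ y, Step R' l p y) ∧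
      (p ≠ q → Conn R' p q base (mate base)) := by
  obtain ⟨R₁, h₁, hle₁, y, hy⟩ := h.exists_step hT hσ l p
  by_cases hpq : p = q
  · exact ⟨R₁, h₁, hle₁, ⟨y, hy⟩, fun h => (h hpq).elim⟩
  · obtain ⟨R₂, h₂, hle₂, hc⟩ := h₁.exists_conn hσ hinj hpq
    exact ⟨R₂, h₂, hle₁.trans hle₂, ⟨y, step_mono hle₂ hy⟩, fun _ => hc⟩

/-! ### The limit of the chain -/

/-- There are countably many tasks, and each needs treatment only once, since steps and connections
persist under enlargement. -/
theorem exists_seq_isState {T : Γ} {σ : Generator → Γ} (hT : T * T = 1)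
    (hσ : ∀ e, σ (bar e) * T = T * σ e) (hinj : Function.Injective (FreeGroup.lift σ)) :
    ∃ R : ℕ → Rel, Monotone R ∧ (∀ n, IsState T σ (R n)) ∧
      (∀ l x, ∃ n y, Step (R n) l x y) ∧
      ∀ p q, p ≠ q → ∃ n, Conn (R n) p q base (mate base) := by
  obtain ⟨task, htask⟩ := exists_surjective_nat ((Generator × Bool) × Point × Point)
  have key : ∀ (n : ℕ) (R : {R // IsState T σ R}), ∃ R' : {R // IsState T σ R}, R.1 ≤ R'.1 ∧
      (∃ y, Step R'.1 (task n).1 (task n).2.1 y) ∧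
      ((task n).2.1 ≠ (task n).2.2 → Conn R'.1 (task n).2.1 (task n).2.2 base (mate base)) :=
    fun n R => by
      obtain ⟨R', h', h⟩ := R.2.exists_task hT hσ hinj (task n).1 (task n).2.1 (task n).2.2
      exact ⟨⟨R', h'⟩, h⟩
  choose next hle hstep hconn using key
  let R : ℕ → {R // IsState T σ R} := fun n => Nat.rec ⟨_, isState_bot hT σ⟩ next n
  refine ⟨fun n => (R n).1, monotone_nat_of_le_succ fun n => hle n (R n), fun n => (R n).2,
    fun l x => ?_, fun p q hpq => ?_⟩
  · obtain ⟨n, hn⟩ := htask (l, x, x)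
    exact ⟨n + 1, by simpa [hn] using hstep n (R n)⟩
  · obtain ⟨n, hn⟩ := htask (((.inl 0), true), p, q)
    exact ⟨n + 1, by simpa [hn] using hconn n (R n) (by simpa [hn] using hpq)⟩

theorem IsPartialAction.acts_right_unique {R : Rel} (hR : IsPartialAction R)
    {L : List (Generator × Bool)} {x y z : Point} (h : Acts R L x y) (h' : Acts R L x z) :
    y = z := by
  induction L generalizing y z with
  | nil => exact h.symm.trans h'
  | cons l L ih =>
    obtain ⟨u, hu, hy⟩ := h
    obtain ⟨v, hv, hz⟩ := h'
    obtain rfl := ih hu hv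
    exact hR.step_right_unique hy hz

theorem exists_acts_of_iSup {R : ℕ → Rel} (hR : Monotone R) {L : List (Generator × Bool)}
    {x y : Point} (h : Acts (fun e u v => ∃ n, R n e u v) L x y) : ∃ n, Acts (R n) L x y := by
  induction L generalizing y with
  | nil => exact ⟨0, h⟩
  | cons l L ih =>
    obtain ⟨u, hu, hy⟩ := h
    obtain ⟨n, hn⟩ := ih hu
    obtain ⟨m, hm⟩ : ∃ m, Step (R m) l u y := by
      rcases l with ⟨e, _ | _⟩
      exacts [hy, hy]
    exact ⟨max n m, u, acts_mono (hR (le_max_left n m)) hn, step_mono (hR (le_max_right n m)) hm⟩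

/-- There is a total action which is transitive on pairs and in which a word closing up at a pair
represents the trivial element. -/
theorem exists_total {T : Γ} {σ : Generator → Γ} (hT : T * T = 1)
    (hσ : ∀ e, σ (bar e) * T = T * σ e) (hinj : Function.Injective (FreeGroup.lift σ)) :
    ∃ R : Rel, IsPartialAction R ∧ (∀ l x, ∃ y, Step R l x y) ∧
      (∀ p q, p ≠ q → Conn R p q base (mate base)) ∧
      ∀ L x y, x ≠ y → (Acts R L x x → Acts R L y y → FreeGroup.lift σ (FreeGroup.mk L) = 1) ∧
        (Acts R L x (mate x) → Acts R L y (mate y) → FreeGroup.lift σ (FreeGroup.mk L) = T) := by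
  obtain ⟨R, hmono, hstate, hstep, hconn⟩ := exists_seq_isState hT hσ hinj
  have hle : ∀ n, R n ≤ fun e u v => ∃ n, R n e u v := fun n e u v h => ⟨n, h⟩
  refine ⟨fun e u v => ∃ n, R n e u v, ⟨?_, ?_, ?_⟩, ?_, ?_, ?_⟩
  · rintro e x y z ⟨n, hn⟩ ⟨m, hm⟩
    exact (hstate (max n m)).1.right_unique (hmono (le_max_left n m) _ _ _ hn)
      (hmono (le_max_right n m) _ _ _ hm)
  · rintro e x y z ⟨n, hn⟩ ⟨m, hm⟩
    exact (hstate (max n m)).1.left_unique (hmono (le_max_left n m) _ _ _ hn)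
      (hmono (le_max_right n m) _ _ _ hm)
  · rintro e x y ⟨n, hn⟩
    exact ⟨n, (hstate n).1.equivariant hn⟩
  · intro l x
    obtain ⟨n, y, hy⟩ := hstep l x
    exact ⟨y, step_mono (hle n) hy⟩
  · intro p q hpq
    obtain ⟨n, hn⟩ := hconn p q hpq
    exact hn.mono (hle n)
  -- The potentials of different stages need not agree. A word applied to a pair uses finitely many
  -- edges, so the potential of one late stage suffices.
  · have key : ∀ {L x x' y y'}, x ≠ y → Acts (fun e u v => ∃ n, R n e u v) L x x' →
        Acts (fun e u v => ∃ n, R n e u v) L y y' → ∃ Φ : Point → Point → Γ,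
        Φ x' y' = FreeGroup.lift σ (FreeGroup.mk L) * Φ x y ∧
        Φ (mate x) (mate y) = T * Φ x y := by
      intro L x x' y y' hxy hx hy
      obtain ⟨n, hn⟩ := exists_acts_of_iSup hmono hx
      obtain ⟨m, hm⟩ := exists_acts_of_iSup hmono hy
      obtain ⟨hR, -, Φ, hΦ⟩ := hstate (max n m)
      exact ⟨Φ, hΦ.map_acts hR hxy (acts_mono (hmono (le_max_left n m)) hn)
        (acts_mono (hmono (le_max_right n m)) hm), hΦ.map_mate x y⟩
    refine fun L x y hxy => ⟨fun hx hy => ?_, fun hx hy => ?_⟩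
    · obtain ⟨Φ, h, -⟩ := key hxy hx hy
      exact mul_eq_right.1 h.symm
    · obtain ⟨Φ, h, h'⟩ := key hxy hx hy
      exact mul_right_cancel (h.symm.trans h')

/-! ### The group as a semidirect product -/

/-- The homomorphism from the group of order two which takes the generator to `h`. -/
def ofInvolution {H : Type*} [Group H] (h : H) (hh : h * h = 1) : Multiplicative (ZMod 2) →* H where
  toFun b := if b = 1 then 1 else h
  map_one' := if_pos rfl
  map_mul' := by
    have key : ∀ b : Multiplicative (ZMod 2), b = 1 ∨ b = .ofAdd 1 := by decide
    intro a b
    rcases key a with rfl | rfl <;> rcases key b with rfl | rfl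
    · simp
    · simp
    · simp
    · rw [if_pos (by decide), if_neg (by decide), hh]

/-- The generator of the group of order two. -/
def gen : Multiplicative (ZMod 2) := .ofAdd 1

theorem eq_one_or_eq_gen : ∀ b : Multiplicative (ZMod 2), b = 1 ∨ b = gen := by decide

theorem gen_mul_gen : gen * gen = 1 := by decide

@[simp] theorem ofInvolution_gen {H : Type*} [Group H] (h : H) (hh : h * h = 1) :
    ofInvolution h hh gen = h := by
  have hne : ¬ gen = 1 := by decide
  simp [ofInvolution, hne]

theorem hom_ext_gen {H : Type*} [Monoid H] {f g : Multiplicative (ZMod 2) →* H}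
    (h : f gen = g gen) : f = g := by
  refine MonoidHom.ext fun b => ?_
  rcases eq_one_or_eq_gen b with rfl | rfl
  exacts [by simp, h]

/-- The automorphism of the free group induced by the distinguished involution. -/
def barAut : MulAut (FreeGroup Generator) :=
  FreeGroup.freeGroupCongr ⟨bar, bar, bar_bar, bar_bar⟩

@[simp] theorem barAut_of (e : Generator) : barAut (.of e) = .of (bar e) := rfl

theorem barAut_mul_barAut : barAut * barAut = 1 := by
  apply MulEquiv.toMonoidHom_injective
  ext e
  simp

/-- The free group on the generators, extended by the distinguished involution. -/
abbrev Model := FreeGroup Generator ⋊[ofInvolution barAut barAut_mul_barAut]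
  Multiplicative (ZMod 2)

/-- The weight of a generator. -/
def weight (e : Generator) : Model := SemidirectProduct.inl (.of e)

/-- The distinguished involution. -/
def invol : Model := SemidirectProduct.inr gen

theorem invol_mul_invol : invol * invol = 1 := by
  rw [invol, ← map_mul, gen_mul_gen, map_one]

theorem weight_bar_mul_invol (e : Generator) : weight (bar e) * invol = invol * weight e := by
  have := SemidirectProduct.inl_aut (φ := ofInvolution barAut barAut_mul_barAut) gen (.of e)
  rw [ofInvolution_gen, barAut_of] at this
  rw [weight, this, weight, invol, map_inv, inv_mul_cancel_right]

theorem lift_weight (w : FreeGroup Generator) :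
    FreeGroup.lift weight w = (SemidirectProduct.inl w : Model) := by
  have : FreeGroup.lift weight = (SemidirectProduct.inl : _ →* Model) := by
    refine FreeGroup.ext_hom _ _ fun e => ?_
    simp [weight]
  rw [this]

/-- Homomorphisms from the model are given by compatible images of the generators. -/
def liftModel {H : Type*} [Group H] (s : Generator → H) (t : H) (ht : t * t = 1)
    (hst : ∀ e, s (bar e) * t = t * s e) : Model →* H :=
  SemidirectProduct.lift (FreeGroup.lift s) (ofInvolution t ht) <| by
    intro g
    rcases eq_one_or_eq_gen g with rfl | rfl
    · ext e; simp
    · ext e; simp [← hst]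

section
variable {H : Type*} [Group H] (s : Generator → H) (t : H) (ht : t * t = 1)
    (hst : ∀ e, s (bar e) * t = t * s e)

@[simp] theorem liftModel_inl (w : FreeGroup Generator) :
    liftModel s t ht hst (SemidirectProduct.inl w) = FreeGroup.lift s w := by
  simp [liftModel]

@[simp] theorem liftModel_weight (e : Generator) : liftModel s t ht hst (weight e) = s e := by
  simp [liftModel, weight]

@[simp] theorem liftModel_invol : liftModel s t ht hst invol = t := by
  simp [liftModel, invol]

end

theorem model_hom_ext {H : Type*} [Group H] {f g : Model →* H}
    (h : ∀ e, f (weight e) = g (weight e)) (h' : f invol = g invol) : f = g := by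
  refine SemidirectProduct.hom_ext ?_ (hom_ext_gen h')
  ext e
  exact h e

theorem prod_hom_ext {M N P : Type*} [Monoid M] [Monoid N] [Monoid P] {f g : M × N →* P}
    (h : f.comp (.inl M N) = g.comp (.inl M N)) (h' : f.comp (.inr M N) = g.comp (.inr M N)) :
    f = g := by
  refine MonoidHom.ext fun ⟨m, n⟩ => ?_
  have hm : f (m, 1) = g (m, 1) := DFunLike.congr_fun h m
  have hn : f (1, n) = g (1, n) := DFunLike.congr_fun h' n
  rw [← mul_one m, ← one_mul n, ← Prod.mk_mul_mk, map_mul, map_mul, hm, hn]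

/-- The group `(C₂ × F) * F`. -/
abbrev Target := Monoid.Coprod (Multiplicative (ZMod 2) × FreeGroup ℕ) (FreeGroup ℕ)

/-- The distinguished involution of the target. -/
def tau : Target := .inl (gen, 1)

theorem tau_mul_tau : tau * tau = 1 := by
  rw [tau, ← map_mul, Prod.mk_mul_mk, gen_mul_gen, one_mul]
  exact map_one _

/-- The generators of the subgroup of index two of the target. -/
def targetGen : Generator → Target
  | .inl i => .inl (1, .of i)
  | .inr (i, false) => .inr (.of i)
  | .inr (i, true) => tau * .inr (.of i) * tau

theorem targetGen_bar_mul_tau (e : Generator) : targetGen (bar e) * tau = tau * targetGen e := by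
  rcases e with i | ⟨i, _ | _⟩
  · simp only [bar, targetGen, tau, ← map_mul, Prod.mk_mul_mk, one_mul, mul_one]
  · simp only [bar, targetGen, Bool.not_false, mul_assoc, tau_mul_tau, mul_one]
  · simp only [bar, targetGen, Bool.not_true, ← mul_assoc, tau_mul_tau, one_mul]

/-- The homomorphism from the target to the model. -/
def toModel : Target →* Model :=
  Monoid.Coprod.lift
    (MonoidHom.noncommCoprod (ofInvolution invol invol_mul_invol)
      (FreeGroup.lift fun i => weight (.inl i)) <| by
      intro b w
      have h : ∀ i, weight (.inl i) * invol = invol * weight (.inl i) := fun i =>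
        weight_bar_mul_invol (.inl i)
      rcases eq_one_or_eq_gen b with rfl | rfl
      · rw [map_one]; exact Commute.one_left _
      · rw [ofInvolution_gen]
        induction w using FreeGroup.induction_on with
        | C1 => rw [map_one]; exact Commute.one_right _
        | of i => simpa using show Commute _ _ from (h i).symm
        | inv_of i hi => rw [map_inv]; exact hi.inv_right
        | mul x y hx hy => rw [map_mul]; exact hx.mul_right hy)
    (FreeGroup.lift fun i => weight (.inr (i, false)))

/-- The group `(C₂ × F) * F` is isomorphic to its model. -/
def targetEquivModel : Target ≃* Model :=
  MonoidHom.toMulEquiv toModel (liftModel targetGen tau tau_mul_tau targetGen_bar_mul_tau)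
    (by
      refine Monoid.Coprod.hom_ext (prod_hom_ext ?_ ?_) ?_
      · exact hom_ext_gen (by simp [toModel, tau])
      · ext i; simp [toModel, targetGen]
      · ext i; simp [toModel, targetGen])
    (by
      refine model_hom_ext (fun e => ?_) ?_
      · rcases e with i | ⟨i, _ | _⟩
        · simp [toModel, targetGen]
        · simp [toModel, targetGen]
        · have := weight_bar_mul_invol (.inr (i, false))
          simp only [bar, Bool.not_false] at this
          have h : weight (.inr (i, true)) = invol * (weight (.inr (i, false)) * invol) := by
            rw [← mul_assoc, ← this, mul_assoc, invol_mul_invol, mul_one]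
          simp [toModel, targetGen, tau, h]
      · simp [toModel, tau])

/-! ### The action and its sharp transitivity -/

/-- The model acts on the points, freely and transitively on pairs of distinct points. -/
theorem exists_model_action : ∃ ρ : Model →* Equiv.Perm Point,
    (∀ x, ρ invol x = mate x) ∧
    (∀ p q, p ≠ q → ∃ g, ρ g p = base ∧ ρ g q = mate base) ∧
    ∀ g x y, x ≠ y → ρ g x = x → ρ g y = y → g = 1 := by
  have hinj : Function.Injective (FreeGroup.lift weight) := fun v w h => by
    rw [lift_weight, lift_weight] at h
    exact SemidirectProduct.inl_injective h
  obtain ⟨R, hR, htotal, hconn, hfree⟩ :=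
    exists_total invol_mul_invol weight_bar_mul_invol hinj
  choose f hf using htotal
  let s : Generator → Equiv.Perm Point := fun e =>
    { toFun := f (e, true)
      invFun := f (e, false)
      left_inv := fun x => hR.left_unique (hf (e, false) (f (e, true) x)) (hf (e, true) x)
      right_inv := fun x => hR.right_unique (hf (e, true) (f (e, false) x)) (hf (e, false) x) }
  let t : Equiv.Perm Point := ⟨mate, mate, mate_mate, mate_mate⟩
  have hst : ∀ e, s (bar e) * t = t * s e := fun e => by
    ext1 x
    exact hR.right_unique (hf (bar e, true) (mate x)) (hR.equivariant (hf (e, true) x))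
  let ρ := liftModel s t (Equiv.ext mate_mate) hst
  have hinvol : ∀ x, ρ invol x = mate x := fun x => by
    rw [liftModel_invol]; rfl
  have hacts : ∀ L x, Acts R L x (ρ (SemidirectProduct.inl (FreeGroup.mk L)) x) := by
    intro L x
    rw [liftModel_inl]
    induction L with
    | nil => rw [← FreeGroup.one_eq_mk, map_one]; rfl
    | cons l L ih =>
      refine ⟨_, ih, ?_⟩
      rw [← List.singleton_append, ← FreeGroup.mul_mk, map_mul, Equiv.Perm.mul_apply]
      rcases l with ⟨e, _ | _⟩
      · simpa using! hf (e, false) _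
      · simpa using! hf (e, true) _
  have hacts' : ∀ {L x y}, Acts R L x y → ρ (SemidirectProduct.inl (FreeGroup.mk L)) x = y :=
    fun h => hR.acts_right_unique (hacts _ _) h
  refine ⟨ρ, hinvol, fun p q hpq => ?_, fun g x y hxy hx hy => ?_⟩
  · obtain ⟨L, ⟨hp, hq⟩ | ⟨hp, hq⟩⟩ := hconn p q hpq
    · exact ⟨_, hacts' hp, hacts' hq⟩
    · refine ⟨invol * SemidirectProduct.inl (FreeGroup.mk L), ?_, ?_⟩
      · rw [map_mul, Equiv.Perm.mul_apply, hacts' hp, hinvol, mate_mate]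
      · rw [map_mul, Equiv.Perm.mul_apply, hacts' hq, hinvol, mate_mate]
  · obtain ⟨w, b⟩ := g
    rw [SemidirectProduct.mk_eq_inl_mul_inr] at hx hy ⊢
    obtain ⟨L, rfl⟩ := Quot.exists_rep w
    have h : ∀ z, Acts R L (ρ (SemidirectProduct.inr b) z)
        (ρ (SemidirectProduct.inl (FreeGroup.mk L) * SemidirectProduct.inr b) z) := fun z => by
      rw [map_mul, Equiv.Perm.mul_apply]
      exact hacts L _
    have hx' := h x
    have hy' := h y
    erw [hx] at hx'
    erw [hy] at hy'
    rcases eq_one_or_eq_gen b with rfl | rfl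
    · rw [map_one, map_one] at hx' hy'
      have := (hfree L x y hxy).1 hx' hy'
      rw [lift_weight] at this
      rw [map_one, mul_one]
      exact this
    -- When `g` is the word times the involution and fixes `x` and `y`, the word acts as `mate` at
    -- `mate x` and `mate y`. Hence it equals the involution and `g = 1`.
    · have hx'' : Acts R L (mate x) (mate (mate x)) := by
        rw [mate_mate, ← hinvol]; exact hx'
      have hy'' : Acts R L (mate y) (mate (mate y)) := by
        rw [mate_mate, ← hinvol]; exact hy'
      have := (hfree L _ _ (mate_injective.ne hxy)).2 hx'' hy''
      rw [lift_weight] at this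
      refine Eq.trans (congrArg (· * invol) this) invol_mul_invol

/-- A criterion for an action to be sharply `2`-transitive of characteristic `2`. -/
theorem isSharplyTwoTransitiveOfCharTwo_of {G X : Type*} [Group G] [MulAction G X] {o o' : X}
    (ho : o ≠ o') (htrans : ∀ p q : X, p ≠ q → ∃ g : G, g • p = o ∧ g • q = o')
    (hfree : ∀ (g : G) (x y : X), x ≠ y → g • x = x → g • y = y → g = 1) {t : G}
    (ht : ∀ x : X, t • x ≠ x) (hto : t • o = o') (hto' : t • o' = o) :
    IsSharplyTwoTransitiveOfCharTwo G X where
  isSharplyTwoTransitive :=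
    { nonempty_tuples := ⟨⟨![o, o'], by
        intro i j hij
        fin_cases i <;> fin_cases j <;> simp_all [ho.symm]⟩⟩
      existsUnique_smul_eq := by
        intro x y
        have hx : x 0 ≠ x 1 := x.injective.ne (by decide)
        have hy : y 0 ≠ y 1 := y.injective.ne (by decide)
        obtain ⟨g, hg, hg'⟩ := htrans _ _ hx
        obtain ⟨h, hh, hh'⟩ := htrans _ _ hy
        refine ⟨h⁻¹ * g, ?_, fun k hk => ?_⟩
        · simp [Fin.forall_fin_two, mul_smul, hg, hg', inv_smul_eq_iff, hh, hh']
        · have : (h⁻¹ * g)⁻¹ * k = 1 := hfree _ _ _ hx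
            (by simp [mul_smul, hk, hh, inv_smul_eq_iff, hg])
            (by simp [mul_smul, hk, hh', inv_smul_eq_iff, hg'])
          exact (inv_mul_eq_one.1 this).symm }
  involution_smul_ne := by
    rintro h ⟨hne, hsq⟩ x hx
    have hmove : ∃ y : X, h • y ≠ y := by
      by_contra! hall
      exact hne (hfree h o o' ho (hall o) (hall o'))
    obtain ⟨y, hy⟩ := hmove
    obtain ⟨g, hg, hg'⟩ := htrans _ _ hy
    have hhy : h • h • y = y := by rw [← mul_smul, ← sq, hsq, one_smul]
    have hg₁ : g⁻¹ • o = h • y := inv_smul_eq_iff.2 hg.symm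
    have hg₂ : g⁻¹ • o' = y := inv_smul_eq_iff.2 hg'.symm
    -- Since `g` takes `(h • y, y)` to `(o, o')`, the conjugate of `h` by `g` swaps `o` and `o'`
    -- just as `t` does. By freeness it is `t`.
    have key : t⁻¹ * (g * h * g⁻¹) = 1 := by
      refine hfree _ _ _ ho ?_ ?_
      · simp only [mul_smul, hg₁, hhy, hg', inv_smul_eq_iff, hto]
      · simp only [mul_smul, hg₂, hg, inv_smul_eq_iff, hto']
    refine ht (g • x) ?_
    rw [inv_mul_eq_one.1 key, mul_smul, mul_smul, inv_smul_smul, hx]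

end PartialAction

theorem mainTheorem3 :
    ∃ (X : Type)
      (_ : MulAction
        (Monoid.Coprod (Multiplicative (ZMod 2) × FreeGroup ℕ) (FreeGroup ℕ)) X),
      IsSharplyTwoTransitiveOfCharTwo
        (Monoid.Coprod (Multiplicative (ZMod 2) × FreeGroup ℕ) (FreeGroup ℕ)) X := by
  obtain ⟨ρ, hinvol, htrans, hfree⟩ := PartialAction.exists_model_action
  let θ := PartialAction.targetEquivModel
  let act : MulAction PartialAction.Target PartialAction.Point :=
    MulAction.compHom _ (ρ.comp θ.toMonoidHom)
  have hsmul : ∀ (g : PartialAction.Target) (x : PartialAction.Point), g • x = ρ (θ g) x :=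
    fun _ _ => rfl
  have hinvol' : ∀ x : PartialAction.Point, θ.symm PartialAction.invol • x = PartialAction.mate x :=
    fun x => by rw [hsmul, MulEquiv.apply_symm_apply, hinvol]
  refine ⟨PartialAction.Point, act,
    PartialAction.isSharplyTwoTransitiveOfCharTwo_of (o := PartialAction.base)
      (o' := PartialAction.mate PartialAction.base) (t := θ.symm PartialAction.invol)
      (PartialAction.ne_mate _) (fun p q hpq => ?_) (fun g x y hxy hx hy => ?_) (fun x => ?_) ?_ ?_⟩
  · obtain ⟨g, hg⟩ := htrans p q hpq
    exact ⟨θ.symm g, by simpa [hsmul] using hg⟩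
  · exact θ.map_eq_one_iff.1 (hfree _ x y hxy hx hy)
  · rw [hinvol']; exact PartialAction.mate_ne x
  · rw [hinvol']
  · rw [hinvol', PartialAction.mate_mate]
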